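/- Let $\mathbb K$ be a field, let $n\ge 3$ and $d$ be integers, and let $\alpha=(\alpha_1,\dots,\alpha_n)$ be a sequence of integers with $1\le\alpha_1\le\cdots\le\alpha_n\le d$ and $d<\alpha_1+\cdots+\alpha_n$. Put $$V=\{c\in\mathbb N^n : c_1+\cdots+c_n=d,\ c_i\le\alpha_i\text{ for all }i\},$$ and let $\mathcal A_{d,\alpha}\subseteq\mathbb K[x_1,\dots,x_n]$ be the $\mathbb K$-subalgebra generated by the monomials $x^c=x_1^{c_1}\cdots x_n^{c_n}$ with $c\in V$ (the algebra of Veronese type), graded so that each of these generators has degree one; that is, its component of degree $k$ is the $\mathbb K$-span of the products of $k$ generators. The multiplicity $\mathtt e(R)$ of a standard graded $\mathbb K$-algebra $R=\bigoplus_k R_k$ of Krull dimension $D\ge 1$ is defined by the property that the Hilbert function $k\mapsto\dim_{\mathbb K}R_k$ agrees for all large $k$ with a polynomial in $k$ of degree $D-1$ and leading coefficient $\mathtt e(R)/(D-1)!$. For $a,b\in V$ write $x^ax^b=x_{i_1}x_{i_2}\cdots x_{i_{2d}}$ with $i_1\le i_2\le\cdots\le i_{2d}$. The pair $(a,b)$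 is called sorted if $x^a=x_{i_1}x_{i_3}\cdots x_{i_{2d-1}}$ and $x^b=x_{i_2}x_{i_4}\cdots x_{i_{2d}}$. Write $a>_{\mathrm{lex}}b$ if the leftmost nonzero entry of $a-b$ is positive. The sorting graph $\mathcal G(d,\alpha)$ is the simple graph with vertex set $V$ in which, for $a>_{\mathrm{lex}}b$, the pair $\{a,b\}$ is an edge if and only if $(a,b)$ is sorted. A maximal clique is a set of pairwise adjacent vertices that is maximal with respect to inclusion. Then the multiplicity $\mathtt e(\mathcal A_{d,\alpha})$ equals the number of maximal cliques of $\mathcal G(d,\alpha)$. -/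

import Mathlib

namespace VeroneseType

/-- The set of exponent vectors `c ∈ ℕⁿ` with `c₁ + ⋯ + cₙ = d` and `cᵢ ≤ αᵢ` for all `i`. -/
def expVectors {n : ℕ} (d : ℕ) (α : Fin n → ℕ) : Set (Fin n → ℕ) :=
  {c | ∑ i, c i = d ∧ ∀ i, c i ≤ α i}

section Algebra

variable {n : ℕ} (K : Type*) [Field K]

/-- The monomials `x^c` with `c ∈ expVectors d α`. They all have degree `d`, hence they are the
minimal monomial generators of the ideal of Veronese type that they generate. -/
def monomials (d : ℕ) (α : Fin n → ℕ) : Set (MvPolynomial (Fin n) K) :=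
  {f | ∃ c ∈ expVectors d α, f = ∏ i, MvPolynomial.X i ^ c i}

/-- The algebra of Veronese type: the `K`-subalgebra of `K[x₁, …, xₙ]` generated by the
monomials `x^c` with `c ∈ expVectors d α`. -/
noncomputable def algebra (d : ℕ) (α : Fin n → ℕ) : Subalgebra K (MvPolynomial (Fin n) K) :=
  Algebra.adjoin K (monomials K d α)

/-- The standard grading of the algebra of Veronese type, in which every monomial generator has
degree one: the component of degree `k` is the `K`-span of all products of `k` generators
(a power of submodules of an algebra is the span of the products). -/
noncomputable def component (d : ℕ) (α : Fin n → ℕ) (k : ℕ) : Submodule K (algebra K d α) :=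
  Submodule.span K {a : algebra K d α | (a : MvPolynomial (Fin n) K) ∈ monomials K d α} ^ k

end Algebra

/-- `HasMultiplicity K R 𝒜 e`: the `K`-algebra `R` of positive Krull dimension `D`, with
components `𝒜 k`, has multiplicity `e`: its Hilbert function `k ↦ dim_K (𝒜 k)` agrees for all
large `k` with a polynomial of degree `D - 1` and leading coefficient `e / (D - 1)!`. -/
def HasMultiplicity (K R : Type*) [Field K] [CommRing R] [Algebra K R]
    (𝒜 : ℕ → Submodule K R) (e : ℕ) : Prop :=
  ∃ (D : ℕ) (P : Polynomial ℚ), 0 < D ∧ ringKrullDim R = D ∧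
    (∀ᶠ k : ℕ in Filter.atTop, (Module.finrank K (𝒜 k) : ℚ) = P.eval (k : ℚ)) ∧
    P.degree = ((D - 1 : ℕ) : WithBot ℕ) ∧
    P.leadingCoeff = (e : ℚ) / (Nat.factorial (D - 1) : ℚ)

/-- The multiplicity is uniquely determined. -/
theorem HasMultiplicity.unique {K R : Type*} [Field K] [CommRing R] [Algebra K R]
    {𝒜 : ℕ → Submodule K R} {e e' : ℕ}
    (h : HasMultiplicity K R 𝒜 e) (h' : HasMultiplicity K R 𝒜 e') : e = e' := by
  obtain ⟨D, P, _, hD, hP, _, hl⟩ := h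
  obtain ⟨D', P', _, hD', hP', _, hl'⟩ := h'
  have hDD : D = D' := by
    have h1 := hD.symm.trans hD'
    exact_mod_cast h1
  subst hDD
  have hPP : P = P' := by
    obtain ⟨N, hN⟩ := Filter.eventually_atTop.1 (hP.and hP')
    refine Polynomial.eq_of_infinite_eval_eq P P' ?_
    refine ((Set.Ici_infinite N).image (f := fun k : ℕ => (k : ℚ))
      Nat.cast_injective.injOn).mono ?_
    rintro _ ⟨k, hk, rfl⟩
    exact (hN k hk).1.symm.trans (hN k hk).2
  subst hPP
  rw [hl] at hl'
  have hf : (Nat.factorial (D - 1) : ℚ) ≠ 0 := by exact_mod_cast Nat.factorial_ne_zero _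
  have := (div_left_inj' hf).1 hl'
  exact_mod_cast this

section Sorting

variable {n : ℕ}

/-- The weakly increasing list `i₁ ≤ i₂ ≤ ⋯` of indices such that
`x^w = x_{i₁} x_{i₂} ⋯`: the index `j` is repeated `w j` times. -/
def indexList (w : Fin n → ℕ) : List (Fin n) :=
  (List.finRange n).flatMap fun j => List.replicate (w j) j

/-- The sorting operator on `p`-tuples of exponent vectors of degree `d`: if
`u₁ ⋯ u_p = x_{i₁} ⋯ x_{i_{pd}}` with `i₁ ≤ ⋯ ≤ i_{pd}`, then the `k`-th entry of the result is
`x_{i_k} x_{i_{p+k}} ⋯ x_{i_{(d-1)p+k}}`. Here `k` and the positions in the list start at `0`,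
and the value at `j` is the exponent of `x_j`. -/
def sort (d p : ℕ) (u : Fin p → Fin n → ℕ) : Fin p → Fin n → ℕ :=
  fun k j => (Finset.univ.filter fun t : Fin d =>
    (indexList fun l => ∑ q, u q l)[(t : ℕ) * p + (k : ℕ)]? = some j).card

/-- The pair `(a, b)` of exponent vectors of degree `d` is sorted. -/
def IsSortedPair (d : ℕ) (a b : Fin n → ℕ) : Prop :=
  sort d 2 ![a, b] = ![a, b]

/-- `a >_lex b`: the leftmost nonzero entry of `a - b` is positive. -/
def LexGT (a b : Fin n → ℕ) : Prop :=
  ∃ i, (∀ j < i, a j = b j) ∧ b i < a i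

/-- The sorting graph on the vertex set `expVectors d α`: for `a >_lex b`, the pair `{a, b}` is
an edge if and only if `(a, b)` is sorted. -/
def sortingGraph (d : ℕ) (α : Fin n → ℕ) : SimpleGraph (expVectors d α) where
  Adj a b := (LexGT a.1 b.1 ∧ IsSortedPair d a.1 b.1) ∨ (LexGT b.1 a.1 ∧ IsSortedPair d b.1 a.1)
  symm := ⟨fun _ _ h => h.symm⟩
  loopless := ⟨fun a h => by
    rcases h with ⟨⟨i, _, h⟩, _⟩ | ⟨⟨i, _, h⟩, _⟩ <;> exact lt_irrefl _ h⟩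

/-- The set of maximal cliques of the sorting graph, maximal with respect to inclusion. -/
def maximalCliques (d : ℕ) (α : Fin n → ℕ) : Set (Set (expVectors d α)) :=
  {C | Maximal (sortingGraph d α).IsClique C}

end Sorting

end VeroneseType

/-! Encode exponent vectors by their partial sums. A pair is sorted exactly when the partial sums of
the first vector exceed those of the second by 0 or 1 (`isSortedPair_iff`), so cliques of the
sorting graph are sets pairwise comparable under `Near`.

Every lattice point of the `k`-th dilation of the polytope is in exactly one way a sum of `k`
pairwise comparable vertices: existence comes from rounding down translates of the averaged partial
sums (`exists_isCliqueFun`), uniqueness from reading the multiplicities off the partial sums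
(`IsCliqueFun.unique`). Grouping these decompositions by support, the Hilbert function for large `k`
is the sum of `(k - 1).choose (|C| - 1)` over nonempty cliques `C` (`ncard_dilation_eq_sum`,
`finrank_component`).

Cliques have at most `n` elements, so the coefficient of degree `n - 1` counts the cliques of size
`n`, divided by `(n - 1)!`. These are precisely the maximal cliques, because every clique extends to
one of size `n` (`ncard_of_mem_maximalCliques`, by a generic perturbation). Finally the Krull
dimension is `n`, since the polynomial ring is algebraic over the algebra (`ringKrullDim_algebra`).
-/

namespace VeroneseType

/-! ### Partial sums of exponent vectors. -/

section PartialSums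

variable {n : ℕ}

/-- The partial sum of the first `j` entries of `c`. -/
def psum (c : Fin n → ℕ) (j : ℕ) : ℕ := ∑ i : Fin n, if i.val < j then c i else 0

@[simp] lemma psum_zero (c : Fin n → ℕ) : psum c 0 = 0 := by simp [psum]

lemma psum_of_le (c : Fin n → ℕ) {j : ℕ} (h : n ≤ j) : psum c j = ∑ i, c i :=
  Finset.sum_congr rfl fun i _ => if_pos (i.2.trans_le h)

lemma psum_succ (c : Fin n → ℕ) (j : Fin n) : psum c (j + 1) = psum c j + c j := by
  have h : c j = ∑ i : Fin n, if i = j then c i else 0 := by simp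
  rw [psum, psum, h, ← Finset.sum_add_distrib]
  refine Finset.sum_congr rfl fun i _ => ?_
  rcases lt_trichotomy i j with h | h | h
  · have : i.val < j.val := h
    simp [this, h.ne, this.le]
  · simp [h]
  · simp [h.ne', h.not_ge, h.not_gt]

lemma psum_mono (c : Fin n → ℕ) : Monotone (psum c) := by
  intro a b h
  refine Finset.sum_le_sum fun i _ => ?_
  split_ifs <;> omega

lemma psum_le (c : Fin n → ℕ) (j : ℕ) : psum c j ≤ ∑ i, c i :=
  Finset.sum_le_sum fun i _ => by split_ifs <;> simp

lemma psum_injective : Function.Injective (psum : (Fin n → ℕ) → ℕ → ℕ) := by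
  intro a b h
  funext j
  have h1 := psum_succ a j
  have h2 := psum_succ b j
  rw [h] at h1
  omega

lemma psum_sum {ι : Type*} (s : Finset ι) (m : ι → ℕ) (c : ι → Fin n → ℕ) (j : ℕ) :
    psum (fun i => ∑ x ∈ s, m x * c x i) j = ∑ x ∈ s, m x * psum (c x) j := by
  simp only [psum, Finset.mul_sum]
  rw [Finset.sum_comm]
  refine Finset.sum_congr rfl fun i _ => ?_
  split_ifs <;> simp

lemma psum_succ_index {w : Fin (n + 1) → ℕ} (j : ℕ) :
    psum w (j + 1) = w 0 + psum (fun i => w i.succ) j := by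
  simp [psum, Fin.sum_univ_succ]

lemma eq_of_psum_eq_of_le {a b : Fin n → ℕ} (h : ∀ j ≤ n, psum a j = psum b j) : a = b := by
  funext j
  have h1 := psum_succ a j
  have h2 := psum_succ b j
  have := h j j.2.le
  have := h (j + 1) j.2
  omega

end PartialSums

/-! ### Sortedness in terms of partial sums. -/

section SortedPairs

lemma indexList_succ {n : ℕ} (w : Fin (n + 1) → ℕ) :
    indexList w = List.replicate (w 0) 0 ++ (indexList fun i => w i.succ).map Fin.succ := by
  simp [indexList, List.finRange_succ, List.flatMap_map, List.map_flatMap]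

/-- The copies of `j` form a consecutive block; this turns the list in `sort` into inequalities
between partial sums. -/
lemma indexList_getElem?_eq_some {n : ℕ} (w : Fin n → ℕ) (m : ℕ) (j : Fin n) :
    (indexList w)[m]? = some j ↔ psum w j ≤ m ∧ m < psum w (j + 1) := by
  induction n generalizing m with
  | zero => exact j.elim0
  | succ n ih =>
    rw [indexList_succ, List.getElem?_append]
    simp only [List.length_replicate, List.getElem?_map]
    refine Fin.cases ?_ (fun i => ?_) j
    · split_ifs with h
      · simp [psum_succ_index, h]
      · simp [psum_succ_index, Fin.succ_ne_zero, h]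
    · have : (i.succ : Fin (n + 1)).val = i.val + 1 := rfl
      rw [this, psum_succ_index, psum_succ_index]
      split_ifs with h
      · simp [h, (Fin.succ_ne_zero i).symm]
        omega
      · have := ih (fun i => w i.succ) (m - w 0) i
        simp only [Option.map_eq_some_iff, Fin.succ_inj, exists_eq_right, this]
        omega

variable {n d : ℕ}

/-- The blocks of the indices below `j` tile the interval from 0 to `psum w j`. -/
lemma psum_card_filter (f : ℕ → ℕ) (w : Fin n → ℕ) (j : ℕ) (hj : j ≤ n) :
    psum (fun i : Fin n => (Finset.univ.filter fun t : Fin d =>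
      psum w i ≤ f t ∧ f t < psum w (i + 1)).card) j =
    (Finset.univ.filter fun t : Fin d => f t < psum w j).card := by
  induction j with
  | zero => simp
  | succ j ih =>
    have := psum_succ (fun i : Fin n => (Finset.univ.filter fun t : Fin d =>
      psum w i ≤ f t ∧ f t < psum w (i + 1)).card) ⟨j, hj⟩
    rw [this, ih (by omega), ← Finset.card_union_of_disjoint]
    · congr 1
      ext t
      have := psum_mono w (Nat.le_succ j)
      simp only [Finset.mem_union, Finset.mem_filter, Finset.mem_univ, true_and]
      simp only [Nat.succ_eq_add_one] at this
      omega
    · rw [Finset.disjoint_filter]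
      intro t _ h
      simp only
      omega

lemma card_filter_two_mul_add_lt {k x : ℕ} (hk : k < 2) (hx : x ≤ 2 * d) :
    (Finset.univ.filter fun t : Fin d => (t : ℕ) * 2 + k < x).card = (x + 1 - k) / 2 := by
  have : (Finset.univ.filter fun t : Fin d => (t : ℕ) * 2 + k < x) =
      Finset.univ.filter fun t : Fin d => (t : ℕ) < (x + 1 - k) / 2 := by
    ext t
    simp only [Finset.mem_filter, Finset.mem_univ, true_and]
    omega
  rw [this, Fin.card_filter_val_lt]
  omega

lemma psum_add (a b : Fin n → ℕ) (j : ℕ) : psum (fun i => a i + b i) j = psum a j + psum b j := by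
  simp only [psum, ← Finset.sum_add_distrib]
  refine Finset.sum_congr rfl fun i _ => ?_
  split_ifs <;> simp

/-- Entry `k` collects the positions of parity `k`, so its partial sum is half of `psum a j + psum b
j`, rounded up for `k = 0` and down for `k = 1`. -/
lemma psum_sort_two {a b : Fin n → ℕ} (ha : ∑ i, a i = d) (hb : ∑ i, b i = d) (k : Fin 2)
    {j : ℕ} (hj : j ≤ n) :
    psum (sort d 2 ![a, b] k) j = (psum a j + psum b j + 1 - k) / 2 := by
  have h : sort d 2 ![a, b] k = fun i : Fin n => (Finset.univ.filter fun t : Fin d =>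
      psum (fun i => a i + b i) i ≤ (fun t => t * 2 + k.val) t ∧
        (fun t => t * 2 + k.val) t < psum (fun i => a i + b i) (i + 1)).card := by
    funext i
    simp only [sort, indexList_getElem?_eq_some, Fin.sum_univ_two, Matrix.cons_val_zero,
      Matrix.cons_val_one]
  rw [h, psum_card_filter (f := fun t => t * 2 + k.val) _ _ hj,
    card_filter_two_mul_add_lt k.2, psum_add]
  have := psum_le a j
  have := psum_le b j
  rw [psum_add]
  omega

/-- All partial sums of `b` exceed those of `a` by zero or one. -/
def Near (a b : Fin n → ℕ) : Prop := ∀ j, psum a j ≤ psum b j ∧ psum b j ≤ psum a j + 1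

lemma near_of_le {a b : Fin n → ℕ}
    (h : ∀ j ≤ n, psum a j ≤ psum b j ∧ psum b j ≤ psum a j + 1) : Near a b := by
  intro j
  rcases le_total j n with hj | hj
  · exact h j hj
  · have := h n le_rfl
    rwa [psum_of_le _ hj, psum_of_le _ hj, ← psum_of_le a le_rfl, ← psum_of_le b le_rfl]

lemma isSortedPair_iff {a b : Fin n → ℕ} (ha : ∑ i, a i = d) (hb : ∑ i, b i = d) :
    IsSortedPair d a b ↔ Near b a := by
  have h0 := fun j hj => psum_sort_two (j := j) ha hb 0 hj
  have h1 := fun j hj => psum_sort_two (j := j) ha hb 1 hj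
  simp only [Fin.val_zero, Fin.val_one] at h0 h1
  constructor
  · intro h
    rw [h] at h0 h1
    refine near_of_le fun j hj => ?_
    have := h0 j hj
    have := h1 j hj
    simp only [Matrix.cons_val_zero, Matrix.cons_val_one] at *
    omega
  · intro h
    funext k
    refine eq_of_psum_eq_of_le fun j hj => ?_
    have := h j
    fin_cases k
    · have := h0 j hj
      simp only [Fin.zero_eta, Matrix.cons_val_zero] at *
      omega
    · have := h1 j hj
      simp only [Fin.mk_one, Matrix.cons_val_one, Matrix.cons_val_zero] at *
      omega

/-- The partial sums first separate just after the first differing entry. Hence the lexicographic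
condition on edges is automatic. -/
lemma Near.lexGT {a b : Fin n → ℕ} (h : Near b a) (hab : a ≠ b) : LexGT a b := by
  obtain ⟨i, hi⟩ := Function.ne_iff.1 hab
  have hne : (Finset.univ.filter fun i => a i ≠ b i).Nonempty := ⟨i, by simpa using hi⟩
  set i₀ := (Finset.univ.filter fun i => a i ≠ b i).min' hne with hi₀
  have hmem : a i₀ ≠ b i₀ := by simpa using (Finset.mem_filter.1 (Finset.min'_mem _ hne)).2
  have hlt : ∀ j < i₀, a j = b j := by
    intro j hj
    by_contra hc
    exact absurd (Finset.min'_le _ j (by simpa using hc)) (not_le.2 hj)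
  refine ⟨i₀, hlt, ?_⟩
  have hp : psum a i₀ = psum b i₀ := by
    refine Finset.sum_congr rfl fun j _ => ?_
    split_ifs with hj
    · exact hlt j hj
    · rfl
  have := psum_succ a i₀
  have := psum_succ b i₀
  have := h (i₀ + 1)
  omega

lemma LexGT.ne {a b : Fin n → ℕ} (h : LexGT a b) : a ≠ b := by
  rintro rfl
  obtain ⟨i, _, h⟩ := h
  exact lt_irrefl _ h

lemma sortingGraph_adj_iff {α : Fin n → ℕ} {a b : expVectors d α} :
    (sortingGraph d α).Adj a b ↔ a ≠ b ∧ (Near a.1 b.1 ∨ Near b.1 a.1) := by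
  change (LexGT a.1 b.1 ∧ IsSortedPair d a.1 b.1) ∨ (LexGT b.1 a.1 ∧ IsSortedPair d b.1 a.1) ↔ _
  rw [isSortedPair_iff a.2.1 b.2.1, isSortedPair_iff b.2.1 a.2.1]
  constructor
  · rintro (⟨h, h'⟩ | ⟨h, h'⟩)
    · exact ⟨fun e => h.ne (congrArg _ e), Or.inr h'⟩
    · exact ⟨fun e => h.ne (congrArg _ e.symm), Or.inl h'⟩
  · rintro ⟨hne, h | h⟩
    · exact Or.inr ⟨h.lexGT fun e => hne (Subtype.ext e.symm), h⟩
    · exact Or.inl ⟨h.lexGT fun e => hne (Subtype.ext e), h⟩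

end SortedPairs


/-! ### Rounding real points of the polytope to vertices. -/

section FloorVectors

variable {n d : ℕ} {α : Fin n → ℕ}

/-- The exponent vector whose partial sums are the integer parts of the translates `q j + θ`. -/
noncomputable def floorVec (q : ℕ → ℝ) (θ : ℝ) : Fin n → ℕ :=
  fun i => ⌊q (i + 1) + θ⌋₊ - ⌊q i + θ⌋₊

/-- `q` is the sequence of partial sums of a real point of the polytope spanned by
`expVectors d α`. -/
structure IsPolytopePoint (d : ℕ) (α : Fin n → ℕ) (q : ℕ → ℝ) : Prop where
  zero : q 0 = 0
  last : q n = d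
  le_succ : ∀ i : Fin n, q i ≤ q (i + 1)
  succ_le : ∀ i : Fin n, q (i + 1) ≤ q i + α i

namespace IsPolytopePoint

variable {q : ℕ → ℝ} {θ θ' : ℝ}

lemma nonneg (h : IsPolytopePoint d α q) {j : ℕ} (hj : j ≤ n) : 0 ≤ q j := by
  induction j with
  | zero => exact h.zero.ge
  | succ j ih => exact (ih (by omega)).trans (h.le_succ ⟨j, hj⟩)

lemma psum_floorVec (h : IsPolytopePoint d α q) (h1 : θ < 1) {j : ℕ} (hj : j ≤ n) :
    psum (floorVec q θ : Fin n → ℕ) j = ⌊q j + θ⌋₊ := by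
  induction j with
  | zero => simp [h.zero, Nat.floor_eq_zero.2 h1]
  | succ j ih =>
    rw [psum_succ (floorVec q θ) ⟨j, hj⟩]
    simp only
    rw [ih (by omega)]
    have : ⌊q j + θ⌋₊ ≤ ⌊q (j + 1) + θ⌋₊ :=
      Nat.floor_le_floor (add_le_add_left (h.le_succ ⟨j, hj⟩) θ)
    simp only [floorVec]
    omega

/-- The constraints survive rounding because `d` and the `α i` are integers. -/
lemma floorVec_mem (h : IsPolytopePoint d α q) (h0 : 0 ≤ θ) (h1 : θ < 1) :
    (floorVec q θ : Fin n → ℕ) ∈ expVectors d α := by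
  constructor
  · rw [← psum_of_le _ le_rfl, h.psum_floorVec h1 le_rfl, h.last, add_comm,
      Nat.floor_add_natCast h0, Nat.floor_eq_zero.2 h1, zero_add]
  · intro i
    have h2 : ⌊q (i + 1) + θ⌋₊ ≤ ⌊q i + θ + α i⌋₊ :=
      Nat.floor_le_floor (by linarith [h.succ_le i])
    rw [Nat.floor_add_natCast (add_nonneg (h.nonneg i.2.le) h0)] at h2
    simp only [floorVec]
    omega

/-- A shift by less than one raises each floor by at most one. -/
lemma near_floorVec (h : IsPolytopePoint d α q) (h0 : 0 ≤ θ) (hθ : θ ≤ θ') (h1 : θ' < 1) :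
    Near (floorVec q θ : Fin n → ℕ) (floorVec q θ') := by
  refine near_of_le fun j hj => ?_
  rw [h.psum_floorVec (hθ.trans_lt h1) hj, h.psum_floorVec h1 hj]
  refine ⟨Nat.floor_le_floor (by linarith), ?_⟩
  rw [← Nat.floor_add_one (add_nonneg (h.nonneg hj) h0)]
  exact Nat.floor_le_floor (by linarith)

lemma near_or_near_floorVec (h : IsPolytopePoint d α q) (h0 : 0 ≤ θ) (h1 : θ < 1)
    (h0' : 0 ≤ θ') (h1' : θ' < 1) :
    Near (floorVec q θ : Fin n → ℕ) (floorVec q θ') ∨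
      Near (floorVec q θ' : Fin n → ℕ) (floorVec q θ) :=
  (le_total θ θ').imp (fun h2 => h.near_floorVec h0 h2 h1') fun h2 => h.near_floorVec h0' h2 h1

end IsPolytopePoint

end FloorVectors

/-! ### Unique decomposition of lattice points into sorted vectors. -/

section Decomposition

variable {n d : ℕ} {α : Fin n → ℕ}

lemma expVectors_finite (d : ℕ) (α : Fin n → ℕ) : (expVectors d α).Finite :=
  (Set.finite_Iic α).subset fun _ hc i => hc.2 i

noncomputable instance (d : ℕ) (α : Fin n → ℕ) : Fintype (expVectors d α) :=
  (expVectors_finite d α).fintype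

lemma Near.antisymm {a b : Fin n → ℕ} (h : Near a b) (h' : Near b a) : a = b :=
  psum_injective <| funext fun j => le_antisymm (h j).1 (h' j).1

lemma Near.refl (a : Fin n → ℕ) : Near a a := fun _ => ⟨le_rfl, Nat.le_succ _⟩

/-- The multiplicity function `m` is supported on a clique of the sorting graph. -/
def IsCliqueFun (m : expVectors d α → ℕ) : Prop :=
  ∀ a b, m a ≠ 0 → m b ≠ 0 → Near a.1 b.1 ∨ Near b.1 a.1

open Classical in
/-- The number of elements, with multiplicities, strictly below `c`. -/
noncomputable def lowerCount (m : expVectors d α → ℕ) (c : expVectors d α) : ℕ :=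
  ∑ x, if Near x.1 c.1 ∧ x ≠ c then m x else 0

namespace IsCliqueFun

variable {m : expVectors d α → ℕ} {c : expVectors d α}

/-- In the support, vectors below `c` lose at most one in each partial sum and the others lose
nothing. Together with `add_le_mul_psum` this traps `psum c.1 j` as a rounded average, for each of
`m c` consecutive offsets starting at `lowerCount m c`. -/
lemma mul_psum_le (hm : IsCliqueFun m) (hc : m c ≠ 0) (j : ℕ) :
    (∑ x, m x) * psum c.1 j ≤ ∑ x, m x * psum x.1 j + lowerCount m c := by
  classical
  rw [Finset.sum_mul, lowerCount, ← Finset.sum_add_distrib]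
  refine Finset.sum_le_sum fun x _ => ?_
  rcases eq_or_ne (m x) 0 with h0 | h0
  · simp [h0]
  rcases eq_or_ne x c with rfl | hx
  · simp
  rcases hm x c h0 hc with h | h
  · rw [if_pos ⟨h, hx⟩]
    calc m x * psum c.1 j ≤ m x * (psum x.1 j + 1) := Nat.mul_le_mul_left _ (h j).2
      _ = _ := by ring
  · exact (Nat.mul_le_mul_left _ (h j).1).trans (Nat.le_add_right _ _)

lemma add_le_mul_psum (hm : IsCliqueFun m) (hc : m c ≠ 0) (j : ℕ) :
    ∑ x, m x * psum x.1 j + lowerCount m c + m c ≤ (∑ x, m x) * psum c.1 j + ∑ x, m x := by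
  classical
  have h1 : m c = ∑ x, if x = c then m x else 0 := by simp
  rw [Finset.sum_mul, lowerCount]
  nth_rw 1 [h1]
  rw [← Finset.sum_add_distrib, ← Finset.sum_add_distrib, ← Finset.sum_add_distrib]
  refine Finset.sum_le_sum fun x _ => ?_
  rcases eq_or_ne (m x) 0 with h0 | h0
  · simp [h0]
  rcases eq_or_ne x c with rfl | hx
  · simp
  by_cases h : Near x.1 c.1
  · simpa [h, hx] using Nat.mul_le_mul_left _ (h j).1
  · have h' := (hm x c h0 hc).resolve_left h
    simp only [h, hx, false_and, if_false, add_zero]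
    calc m x * psum x.1 j ≤ m x * (psum c.1 j + 1) := Nat.mul_le_mul_left _ (h' j).2
      _ = _ := by ring

open Classical in
/-- The multiplicities are determined by the degree and the sum. -/
lemma eq_card_filter (hm : IsCliqueFun m) {k : ℕ} (hk : ∑ x, m x = k) {w : Fin n → ℕ}
    (hw : ∀ i, ∑ x, m x * x.1 i = w i) (c : expVectors d α) :
    m c = (Finset.univ.filter fun t : Fin k => ∀ j, (psum w j + t) / k = psum c.1 j).card := by
  have hS : ∀ j, psum w j = ∑ x, m x * psum x.1 j := fun j => by
    rw [← psum_sum, ← funext hw]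
  set N : expVectors d α → ℕ := fun c =>
    (Finset.univ.filter fun t : Fin k => ∀ j, (psum w j + t) / k = psum c.1 j).card with hN
  -- The offsets from `lowerCount m c` up to `lowerCount m c + m c - 1` all round to the partial
  -- sums of `c`.
  have hle : ∀ c, m c ≤ N c := by
    intro c
    rcases eq_or_ne (m c) 0 with h0 | h0
    · simp [h0]
    have hlt : lowerCount m c + m c ≤ k := by
      have := hm.add_le_mul_psum h0 0
      simpa [hk] using this
    have hinj : Function.Injective fun s : Fin (m c) =>
        (⟨lowerCount m c + s, by omega⟩ : Fin k) := by
      intro s s' h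
      simp only [Fin.mk.injEq] at h
      exact Fin.ext (by omega)
    calc m c = (Finset.univ.map ⟨_, hinj⟩).card := by simp
      _ ≤ N c := by
        refine Finset.card_le_card fun t ht => ?_
        obtain ⟨s, -, rfl⟩ := Finset.mem_map.1 ht
        simp only [Finset.mem_filter, Finset.mem_univ, true_and, Function.Embedding.coeFn_mk]
        intro j
        have h1 := hm.mul_psum_le h0 j
        have h2 := hm.add_le_mul_psum h0 j
        rw [hk, ← hS] at h1 h2
        have h3 := s.2
        refine (Nat.div_eq_iff (by omega)).2 ⟨?_, ?_⟩
        · rw [mul_comm]; omega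
        · rw [mul_comm]; omega
  have hsum : ∑ c, N c ≤ k := by
    rw [hN, ← Finset.card_biUnion]
    · exact (Finset.card_le_univ _).trans (by simp)
    · intro a _ b _ hab
      rw [Function.onFun, Finset.disjoint_filter]
      intro t _ h1 h2
      exact hab (Subtype.ext (psum_injective (funext fun j => (h1 j).symm.trans (h2 j))))
  -- The sets counted by `N` are disjoint in `Fin k` while `m` already sums to `k`, so the termwise
  -- inequality is an equality.
  have heq : ∑ c, m c = ∑ c, N c :=
    le_antisymm (Finset.sum_le_sum fun c _ => hle c) (hsum.trans hk.ge)
  exact (Finset.sum_eq_sum_iff_of_le fun c _ => hle c).1 heq c (Finset.mem_univ _)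

lemma unique (hm : IsCliqueFun m) {m' : expVectors d α → ℕ} (hm' : IsCliqueFun m')
    (hk : ∑ x, m x = ∑ x, m' x) (hw : ∀ i, ∑ x, m x * x.1 i = ∑ x, m' x * x.1 i) : m = m' := by
  funext c
  rw [hm.eq_card_filter rfl (fun i => rfl) c, hm'.eq_card_filter hk.symm (fun i => (hw i).symm) c]

end IsCliqueFun

/-- Hermite's identity: raising `S` by one replaces the term `S / k` by `(S + k) / k`. -/
lemma sum_range_add_div (S : ℕ) {k : ℕ} (hk : 0 < k) :
    ∑ t ∈ Finset.range k, (S + t) / k = S := by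
  induction S with
  | zero =>
    refine Finset.sum_eq_zero fun t ht => ?_
    rw [zero_add]
    exact Nat.div_eq_of_lt (Finset.mem_range.1 ht)
  | succ S ih =>
    have h1 := Finset.sum_range_succ (fun t => (S + t) / k) k
    have h2 := Finset.sum_range_succ' (fun t => (S + t) / k) k
    rw [h1, ih, Nat.add_div_right _ hk] at h2
    simp only [add_zero] at h2
    have h3 : ∀ t, (S + 1 + t) / k = (S + (t + 1)) / k := fun t => by rw [add_assoc, add_comm 1]
    simp only [h3]
    omega

lemma isPolytopePoint_psum_div {k : ℕ} (hk : 0 < k) {w : Fin n → ℕ} (hw : ∑ i, w i = k * d)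
    (hα : ∀ i, w i ≤ k * α i) : IsPolytopePoint d α fun j => (psum w j : ℝ) / k := by
  have hk' : (0 : ℝ) < k := by exact_mod_cast hk
  refine ⟨by simp, ?_, fun i => ?_, fun i => ?_⟩
  · rw [psum_of_le _ le_rfl, hw]
    push_cast
    field_simp
  · gcongr
    exact psum_mono w (Nat.le_succ _)
  · rw [psum_succ, div_add' _ _ _ hk'.ne']
    gcongr
    have : (w i : ℝ) ≤ k * α i := by exact_mod_cast hα i
    push_cast
    linarith

/-- Every lattice point of the `k`-th dilation is a sum of `k` pairwise sorted vectors. -/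
lemma exists_isCliqueFun {k : ℕ} (hk : 0 < k) {w : Fin n → ℕ} (hw : ∑ i, w i = k * d)
    (hα : ∀ i, w i ≤ k * α i) :
    ∃ m : expVectors d α → ℕ, IsCliqueFun m ∧ ∑ x, m x = k ∧ ∀ i, ∑ x, m x * x.1 i = w i := by
  classical
  have hk' : (0 : ℝ) < k := by exact_mod_cast hk
  have hq := isPolytopePoint_psum_div (d := d) hk hw hα
  set q : ℕ → ℝ := fun j => (psum w j : ℝ) / k with hqdef
  have hθ : ∀ t : Fin k, 0 ≤ (t : ℝ) / k ∧ (t : ℝ) / k < 1 := fun t =>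
    ⟨by positivity, (div_lt_one hk').2 (by exact_mod_cast t.2)⟩
  -- The `k` summands are the roundings of `w / k` at the equally spaced offsets `t / k`; Hermite's
  -- identity shows that they add up to `w`.
  set u : Fin k → expVectors d α := fun t => ⟨floorVec q (t / k), hq.floorVec_mem (hθ t).1 (hθ t).2⟩
    with hu
  have key : ∀ f : expVectors d α → ℕ,
      ∑ x, (Finset.univ.filter fun t => u t = x).card * f x = ∑ t, f (u t) := by
    intro f
    rw [← Finset.sum_fiberwise Finset.univ u]
    refine Finset.sum_congr rfl fun x _ => ?_
    rw [Finset.sum_congr rfl (g := fun _ => f x)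
      (fun t ht => by rw [(Finset.mem_filter.1 ht).2]), Finset.sum_const, smul_eq_mul]
  refine ⟨fun x => (Finset.univ.filter fun t => u t = x).card, ?_, ?_, ?_⟩
  · intro a b ha hb
    obtain ⟨t, ht⟩ := Finset.card_ne_zero.1 ha
    obtain ⟨s, hs⟩ := Finset.card_ne_zero.1 hb
    rw [← (Finset.mem_filter.1 ht).2, ← (Finset.mem_filter.1 hs).2]
    exact hq.near_or_near_floorVec (hθ t).1 (hθ t).2 (hθ s).1 (hθ s).2
  · simpa using key fun _ => 1
  · refine congrFun (eq_of_psum_eq_of_le fun j hj => ?_)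
    rw [psum_sum, key fun x => psum x.1 j]
    have : ∀ t : Fin k, psum (u t).1 j = (psum w j + t) / k := by
      intro t
      simp only [hu]
      rw [hq.psum_floorVec (hθ t).2 hj, hqdef, ← add_div, ← Nat.floor_div_eq_div (K := ℝ)]
      push_cast
      rfl
    simp only [this]
    rw [Fin.sum_univ_eq_sum_range (fun t => (psum w j + t) / k), sum_range_add_div _ hk]

end Decomposition


/-! ### All maximal cliques have `n` elements. -/

section Purity

variable {n d : ℕ} {α : Fin n → ℕ}

lemma isClique_iff {C : Set (expVectors d α)} :
    (sortingGraph d α).IsClique C ↔ ∀ a ∈ C, ∀ b ∈ C, Near a.1 b.1 ∨ Near b.1 a.1 := by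
  constructor
  · intro h a ha b hb
    rcases eq_or_ne a b with rfl | hab
    · exact Or.inl (Near.refl _)
    · exact (sortingGraph_adj_iff.1 (h ha hb hab)).2
  · intro h a ha b hb hab
    exact sortingGraph_adj_iff.2 ⟨hab, h a ha b hb⟩

/-- The sum of the partial sums at the inner positions. -/
def psumTotal (c : Fin n → ℕ) : ℕ := ∑ j ∈ Finset.range (n - 1), psum c (j + 1)

lemma Near.psumTotal_le {a b : Fin n → ℕ} (h : Near a b) : psumTotal a ≤ psumTotal b :=
  Finset.sum_le_sum fun _ _ => (h _).1

lemma Near.psumTotal_le_add {a b : Fin n → ℕ} (h : Near a b) :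
    psumTotal b ≤ psumTotal a + (n - 1) := by
  have : psumTotal b ≤ ∑ j ∈ Finset.range (n - 1), (psum a (j + 1) + 1) :=
    Finset.sum_le_sum fun _ _ => (h _).2
  simpa [Finset.sum_add_distrib, psumTotal] using this

lemma Near.eq_of_psumTotal_eq {a b : Fin n → ℕ} (h : Near a b) (hs : ∑ i, a i = ∑ i, b i)
    (ht : psumTotal a = psumTotal b) : a = b := by
  refine eq_of_psum_eq_of_le fun j hj => ?_
  rcases j with _ | j
  · simp
  · rcases hj.eq_or_lt with hj | hj
    · rw [psum_of_le _ hj.ge, psum_of_le _ hj.ge, hs]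
    · exact (Finset.sum_eq_sum_iff_of_le fun j _ => (h (j + 1)).1).1 ht j
        (Finset.mem_range.2 (by omega))

/-- On a clique `psumTotal` is injective, and it exceeds its minimum by at most `n - 1`. -/
lemma card_le_of_isClique (hn : 0 < n) {C : Finset (expVectors d α)}
    (hC : (sortingGraph d α).IsClique (C : Set (expVectors d α))) : C.card ≤ n := by
  rw [isClique_iff] at hC
  rcases C.eq_empty_or_nonempty with rfl | hne
  · simp
  obtain ⟨c₀, h₀, hmin⟩ := C.exists_min_image (fun c => psumTotal c.1) hne
  have hmem : ∀ c ∈ C, psumTotal c.1 ∈ Finset.Icc (psumTotal c₀.1) (psumTotal c₀.1 + (n - 1)) := by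
    intro c hc
    refine Finset.mem_Icc.2 ⟨hmin c hc, ?_⟩
    rcases hC c₀ h₀ c hc with h | h
    · exact h.psumTotal_le_add
    · exact h.psumTotal_le.trans (Nat.le_add_right _ _)
  have hinj : Set.InjOn (fun c : expVectors d α => psumTotal c.1) C := by
    intro a ha b hb hab
    rcases hC a ha b hb with h | h
    · exact Subtype.ext (h.eq_of_psumTotal_eq (a.2.1.trans b.2.1.symm) hab)
    · exact Subtype.ext (h.eq_of_psumTotal_eq (b.2.1.trans a.2.1.symm) hab.symm).symm
  have := Finset.card_le_card_of_injOn _ hmem hinj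
  simp only [Nat.card_Icc] at this
  omega

namespace IsPolytopePoint

variable {q : ℕ → ℝ}

lemma le_last (h : IsPolytopePoint d α q) {j : ℕ} (hj : j ≤ n) : q j ≤ d := by
  rw [← h.last]
  suffices ∀ l, j + l ≤ n → q j ≤ q (j + l) by
    have := this (n - j) (by omega)
    rwa [Nat.add_sub_cancel' hj] at this
  intro l
  induction l with
  | zero => simp
  | succ l ih => exact fun hl => (ih (by omega)).trans (h.le_succ ⟨j + l, by omega⟩)

lemma convexComb {q' : ℕ → ℝ} (h : IsPolytopePoint d α q) (h' : IsPolytopePoint d α q') {ε : ℝ}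
    (h0 : 0 ≤ ε) (h1 : ε ≤ 1) : IsPolytopePoint d α fun j => (1 - ε) * q j + ε * q' j := by
  have h2 : 0 ≤ 1 - ε := by linarith
  refine ⟨by simp [h.zero, h'.zero], ?_, fun i => ?_, fun i => ?_⟩
  · rw [h.last, h'.last]; ring
  · have := mul_le_mul_of_nonneg_left (h.le_succ i) h2
    have := mul_le_mul_of_nonneg_left (h'.le_succ i) h0
    linarith
  · have := mul_le_mul_of_nonneg_left (h.succ_le i) h2
    have := mul_le_mul_of_nonneg_left (h'.succ_le i) h0
    linarith

end IsPolytopePoint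

/-- The first `n` entries of `q` are pairwise incongruent modulo `1`. -/
def IsGeneric (n : ℕ) (q : ℕ → ℝ) : Prop :=
  ∀ i < n, ∀ j < n, ∀ a b : ℕ, q i + a = q j + b → i = j

/-- A congruence between two different entries would make `√2` rational. -/
lemma isGeneric_of_eq_add_mul_sqrt_two {q : ℕ → ℝ} {σ : ℚ} (hσ : σ ≠ 0)
    (h : ∀ j < n, ∃ r : ℚ, q j = r + σ * j * √2) : IsGeneric n q := by
  intro i hi j hj a b hab
  by_contra hne
  obtain ⟨r, hr⟩ := h i hi
  obtain ⟨s, hs⟩ := h j hj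
  have hij : ((i : ℚ) - j) ≠ 0 := sub_ne_zero.2 (by exact_mod_cast hne)
  have hij' : ((i : ℝ) - j) ≠ 0 := by exact_mod_cast hij
  have hσ' : (σ : ℝ) ≠ 0 := by exact_mod_cast hσ
  refine irrational_sqrt_two ⟨(s + b - r - a) / (σ * (i - j)), ?_⟩
  push_cast
  rw [div_eq_iff (mul_ne_zero hσ' hij')]
  rw [hr, hs] at hab
  linarith

/-- An interior point of the polytope with irrational partial sums. -/
noncomputable def interiorPoint (d : ℕ) (α : Fin n → ℕ) (j : ℕ) : ℝ :=
  d * psum α j / ((∑ i, α i : ℕ) : ℝ) +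
    if j < n then ((1 / (2 * n * (∑ i, α i : ℕ)) : ℚ) : ℝ) * j * √2 else 0

/-- With `A = ∑ i, α i`, the point `d α / A` satisfies each coordinate constraint with slack at
least `1 / A`, and the irrational perturbation changes each coordinate by at most `1 / A`. -/
lemma isPolytopePoint_interiorPoint (hn : 0 < n) (hd : 0 < d) (hpos : ∀ i, 1 ≤ α i)
    (hlt : d < ∑ i, α i) : IsPolytopePoint d α (interiorPoint d α) := by
  set A := ∑ i, α i with hA
  have hA0 : (0 : ℝ) < A := by exact_mod_cast (Nat.zero_le d).trans_lt hlt
  have hn0 : (1 : ℝ) ≤ n := by exact_mod_cast hn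
  set δ : ℝ := ((1 / (2 * n * A) : ℚ) : ℝ) with hδ
  have hδ' : δ = 1 / (2 * n * A) := by rw [hδ]; push_cast; rfl
  have hδ0 : 0 < δ := by rw [hδ']; positivity
  have hs0 : 0 ≤ √2 := Real.sqrt_nonneg _
  have hs2 : √2 ≤ 2 := Real.sqrt_le_iff.2 ⟨by norm_num, by norm_num⟩
  have hbound : δ * n * √2 ≤ 1 / A := by
    calc δ * n * √2 ≤ δ * n * 2 := by gcongr
      _ = 1 / A := by rw [hδ']; field_simp
  have hδs : 0 ≤ δ * √2 := by positivity
  have hδn : δ * √2 ≤ δ * n * √2 := by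
    calc δ * √2 = δ * 1 * √2 := by ring
      _ ≤ _ := by gcongr
  have hlow : ∀ i, 1 / A ≤ d * α i / (A : ℝ) := by
    intro i
    gcongr
    exact_mod_cast Nat.mul_pos hd (hpos i)
  have hupp : ∀ i, d * α i / (A : ℝ) + 1 / A ≤ α i := by
    intro i
    rw [← add_div, div_le_iff₀ hA0]
    have h1 : d * α i + 1 ≤ α i * A := by
      have := Nat.mul_le_mul_left (α i) (Nat.succ_le_of_lt hlt)
      have := hpos i
      have h3 : α i * (d + 1) = d * α i + α i := by ring
      rw [Nat.succ_eq_add_one] at *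
      omega
    exact_mod_cast h1
  have hstep : ∀ i : Fin n, interiorPoint d α (i + 1) - interiorPoint d α i =
      d * α i / (A : ℝ) + (if (i : ℕ) + 1 < n then δ * √2 else -(δ * (i : ℕ) * √2)) := by
    intro i
    simp only [interiorPoint, psum_succ, i.2, if_true, ← hA, ← hδ]
    split_ifs <;> push_cast <;> ring
  have hpert : ∀ i : Fin n, |(if (i : ℕ) + 1 < n then δ * √2 else -(δ * (i : ℕ) * √2))| ≤ 1 / A := by
    intro i
    split_ifs
    · rw [abs_of_nonneg hδs]; exact hδn.trans hbound
    · rw [abs_neg, abs_of_nonneg (by positivity)]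
      refine le_trans ?_ hbound
      gcongr
      exact_mod_cast i.2.le
  refine ⟨by simp [interiorPoint], ?_, fun i => ?_, fun i => ?_⟩
  · simp only [interiorPoint, psum_of_le _ le_rfl, lt_irrefl, if_false, add_zero, ← hA]
    field_simp
  · have h1 := hstep i
    have h2 := abs_le.1 (hpert i)
    have := hlow i
    linarith
  · have h1 := hstep i
    have h2 := abs_le.1 (hpert i)
    have := hupp i
    linarith

lemma interiorPoint_eq {j : ℕ} (hj : j < n) : interiorPoint d α j =
    ((d * psum α j / (∑ i, α i : ℕ) : ℚ) : ℝ) +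
      ((1 / (2 * n * (∑ i, α i : ℕ)) : ℚ) : ℝ) * j * √2 := by
  rw [interiorPoint, if_pos hj]
  push_cast
  rfl

/-- The barycenter of `C` recovers each element of `C` by rounding, with room to spare, so it may be
moved slightly towards `interiorPoint` to become generic. -/
lemma exists_isGeneric_point (hn : 0 < n) (hd : 0 < d) (hpos : ∀ i, 1 ≤ α i)
    (hlt : d < ∑ i, α i) {C : Set (expVectors d α)} (hC : (sortingGraph d α).IsClique C) :
    ∃ q, IsPolytopePoint d α q ∧ IsGeneric n q ∧
      ∀ c ∈ C, ∃ θ : ℝ, 0 ≤ θ ∧ θ < 1 ∧ floorVec q θ = c.1 := by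
  classical
  have hp := isPolytopePoint_interiorPoint hn hd hpos hlt
  have hσ : (1 / (2 * n * (∑ i, α i : ℕ)) : ℚ) ≠ 0 := by
    have : (∑ i, α i : ℕ) ≠ 0 := by omega
    positivity
  rcases C.eq_empty_or_nonempty with rfl | hne
  · exact ⟨_, hp, isGeneric_of_eq_add_mul_sqrt_two hσ fun j hj => ⟨_, interiorPoint_eq hj⟩, by simp⟩
  set m : expVectors d α → ℕ := fun c => if c ∈ C then 1 else 0 with hm
  have hmc : IsCliqueFun m := by
    intro a b ha hb
    simp only [hm, ne_eq, ite_eq_right_iff, one_ne_zero, imp_false, not_not] at ha hb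
    exact isClique_iff.1 hC a ha b hb
  set r := ∑ x, m x with hr
  have hr0 : 0 < r := by
    obtain ⟨c, hc⟩ := hne
    exact Finset.sum_pos' (fun _ _ => Nat.zero_le _) ⟨c, Finset.mem_univ _, by simp [hm, hc]⟩
  have hr0' : (0 : ℝ) < r := by exact_mod_cast hr0
  set w : Fin n → ℕ := fun i => ∑ x, m x * x.1 i with hw
  have hwd : ∑ i, w i = r * d := by
    rw [hw, Finset.sum_comm, hr, Finset.sum_mul]
    refine Finset.sum_congr rfl fun x _ => ?_
    rw [← Finset.mul_sum, x.2.1]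
  have hwα : ∀ i, w i ≤ r * α i := by
    intro i
    rw [hr, Finset.sum_mul]
    exact Finset.sum_le_sum fun x _ => Nat.mul_le_mul_left _ (x.2.2 i)
  have hb := isPolytopePoint_psum_div hr0 hwd hwα
  -- Partial sums lie between 0 and `d`, so the move shifts them by at most `ε * d`, which is less
  -- than `1 / (2 * r)`.
  set ε : ℚ := 1 / (2 * r * d + 1) with hε
  have hε0 : 0 < ε := by positivity
  have hε0' : (0 : ℝ) < ε := by exact_mod_cast hε0
  have hε1 : (ε : ℝ) ≤ 1 := by
    have : ε ≤ 1 := by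
      rw [hε, div_le_one (by positivity)]
      have : (0 : ℚ) ≤ 2 * r * d := by positivity
      linarith
    exact_mod_cast this
  have hεd : r * ε * d < (1 : ℝ) / 2 := by
    have : r * ε * d < (1 : ℚ) / 2 := by
      rw [hε, div_eq_mul_inv, one_mul, mul_right_comm, ← div_eq_mul_inv,
        div_lt_div_iff₀ (by positivity) (by norm_num)]
      linarith
    have := (Rat.cast_lt (K := ℝ)).2 this
    push_cast at this
    exact this
  have hq := hb.convexComb hp hε0'.le hε1
  refine ⟨_, hq, isGeneric_of_eq_add_mul_sqrt_two (mul_ne_zero hε0.ne' hσ) fun j hj => ?_, ?_⟩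
  · refine ⟨(1 - ε) * (psum w j / r) + ε * (d * psum α j / (∑ i, α i : ℕ)), ?_⟩
    rw [interiorPoint_eq hj]
    push_cast
    ring
  · intro c hc
    have hmc0 : m c ≠ 0 := by simp [hm, hc]
    have hmc1 : m c = 1 := by simp [hm, hc]
    have hS : ∀ j, psum w j = ∑ x, m x * psum x.1 j := fun j => by rw [← psum_sum]
    have hlow := hmc.mul_psum_le hmc0
    have hupp := hmc.add_le_mul_psum hmc0
    simp only [← hr, ← hS, hmc1] at hlow hupp
    have ht : lowerCount m c + 1 ≤ r := by simpa using hupp 0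
    have ht' : (lowerCount m c : ℝ) + 1 ≤ r := by exact_mod_cast ht
    have hθ1 : ((lowerCount m c : ℝ) + 1 / 2) / r < 1 := by
      rw [div_lt_one hr0']; linarith
    -- The middle of the interval of offsets that round the barycenter to `c`: it leaves slack `1 /
    -- (2 * r)` on both sides.
    refine ⟨((lowerCount m c : ℝ) + 1 / 2) / r, by positivity, hθ1, ?_⟩
    refine eq_of_psum_eq_of_le fun j hj => ?_
    rw [hq.psum_floorVec hθ1 hj]
    have hl : (r * psum c.1 j : ℝ) ≤ psum w j + lowerCount m c := by exact_mod_cast hlow j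
    have hu : (psum w j + lowerCount m c + 1 : ℝ) ≤ r * psum c.1 j + r := by exact_mod_cast hupp j
    have hb0 := hb.nonneg hj
    have hbd := hb.le_last hj
    have hp0 := hp.nonneg hj
    have hpd := hp.le_last hj
    have hbr : r * ((psum w j : ℝ) / r) = psum w j := by field_simp
    have htr : r * (((lowerCount m c : ℝ) + 1 / 2) / r) = lowerCount m c + 1 / 2 := by field_simp
    have hkey : r * ((1 - ε) * ((psum w j : ℝ) / r) + ε * interiorPoint d α j +
        ((lowerCount m c : ℝ) + 1 / 2) / r) = psum w j + lowerCount m c + 1 / 2 +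
          r * ε * (interiorPoint d α j - (psum w j : ℝ) / r) := by
      rw [mul_add, htr]
      linear_combination hbr
    have hrε : 0 ≤ (r * ε : ℝ) := by positivity
    have h1 : r * ε * (interiorPoint d α j - (psum w j : ℝ) / r) ≤ r * ε * d :=
      mul_le_mul_of_nonneg_left (by linarith) hrε
    have h2 : r * ε * (-d : ℝ) ≤ r * ε * (interiorPoint d α j - (psum w j : ℝ) / r) :=
      mul_le_mul_of_nonneg_left (by linarith) hrε
    rw [Nat.floor_eq_iff (add_nonneg (hq.nonneg hj) (by positivity))]
    constructor
    · refine le_of_mul_le_mul_left ?_ hr0'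
      rw [hkey]
      linarith
    · refine lt_of_mul_lt_mul_left ?_ hr0'.le
      rw [hkey]
      linarith

/-- All roundings of a generic point form a clique containing `C`, hence equal to `C` by maximality.
As `θ` runs through `[0, 1)`, the entries `q i` with `i < n` reach integers at `n` different times,
each giving a new vertex. -/
lemma ncard_of_mem_maximalCliques (hn : 0 < n) (hd : 0 < d) (hpos : ∀ i, 1 ≤ α i)
    (hlt : d < ∑ i, α i) {C : Set (expVectors d α)} (hC : C ∈ maximalCliques d α) :
    C.ncard = n := by
  classical
  obtain ⟨q, hq, hgen, hCq⟩ := exists_isGeneric_point hn hd hpos hlt hC.1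
  set T : Set (expVectors d α) := {v | ∃ θ : ℝ, 0 ≤ θ ∧ θ < 1 ∧ floorVec q θ = v.1} with hT
  have hTc : (sortingGraph d α).IsClique T := by
    rw [isClique_iff]
    rintro a ⟨θ, h0, h1, ha⟩ b ⟨θ', h0', h1', hb⟩
    rw [← ha, ← hb]
    exact hq.near_or_near_floorVec h0 h1 h0' h1'
  have hTC : T ⊆ C := hC.2 hTc fun c hc => hCq c hc
  refine le_antisymm ?_ ?_
  · rw [Set.ncard_eq_toFinset_card']
    exact card_le_of_isClique hn (by simpa using hC.1)
  · have hθ0 : ∀ i : Fin n, 0 ≤ (⌈q i⌉₊ : ℝ) - q i := fun i => sub_nonneg.2 (Nat.le_ceil _)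
    have hθ1 : ∀ i : Fin n, (⌈q i⌉₊ : ℝ) - q i < 1 := fun i => by
      have := Nat.ceil_lt_add_one (hq.nonneg i.2.le)
      linarith
    set f : Fin n → expVectors d α := fun i =>
      ⟨floorVec q ((⌈q i⌉₊ : ℝ) - q i), hq.floorVec_mem (hθ0 i) (hθ1 i)⟩ with hf
    -- At the earlier offset, `q j` has not yet reached the integer `⌈q j⌉₊`, so the `j`-th partial
    -- sums differ.
    have hne : ∀ i j : Fin n, (⌈q i⌉₊ : ℝ) - q i < (⌈q j⌉₊ : ℝ) - q j → f i ≠ f j := by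
      intro i j hlt h
      have h2 : psum (f i).1 j = psum (f j).1 j := by rw [h]
      simp only [hf] at h2
      rw [hq.psum_floorVec (hθ1 i) j.2.le, hq.psum_floorVec (hθ1 j) j.2.le, add_sub_cancel,
        Nat.floor_natCast] at h2
      have h3 : (⌊q j + ((⌈q i⌉₊ : ℝ) - q i)⌋₊ : ℝ) ≤ q j + ((⌈q i⌉₊ : ℝ) - q i) :=
        Nat.floor_le (add_nonneg (hq.nonneg j.2.le) (hθ0 i))
      rw [h2] at h3
      linarith
    have hinj : Function.Injective f := by
      intro i j hij
      rcases lt_trichotomy ((⌈q i⌉₊ : ℝ) - q i) ((⌈q j⌉₊ : ℝ) - q j) with h | h | h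
      · exact absurd hij (hne i j h)
      · exact Fin.ext (hgen i i.2 j j.2 ⌈q j⌉₊ ⌈q i⌉₊ (by linarith))
      · exact absurd hij.symm (hne j i h)
    have hsub : Set.range f ⊆ C := by
      rintro _ ⟨i, rfl⟩
      exact hTC ⟨_, hθ0 i, hθ1 i, rfl⟩
    calc n = (Set.range f).ncard := by
          rw [Set.ncard_range_of_injective hinj]; simp
      _ ≤ C.ncard := Set.ncard_le_ncard hsub (Set.toFinite _)

lemma mem_maximalCliques_iff (hn : 0 < n) (hd : 0 < d) (hpos : ∀ i, 1 ≤ α i)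
    (hlt : d < ∑ i, α i) {C : Set (expVectors d α)} :
    C ∈ maximalCliques d α ↔ (sortingGraph d α).IsClique C ∧ C.ncard = n := by
  classical
  refine ⟨fun h => ⟨h.1, ncard_of_mem_maximalCliques hn hd hpos hlt h⟩, fun ⟨h, hcard⟩ => ⟨h, ?_⟩⟩
  intro D hD hCD
  refine (Set.eq_of_subset_of_ncard_le hCD ?_ (Set.toFinite _)).ge
  rw [hcard, Set.ncard_eq_toFinset_card']
  exact card_le_of_isClique hn (by simpa using hD)

lemma maximalCliques_nonempty (d : ℕ) (α : Fin n → ℕ) : (maximalCliques d α).Nonempty := by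
  obtain ⟨C, -, hC⟩ := (Set.toFinite {C | (sortingGraph d α).IsClique C}).exists_le_maximal
    (a := ∅) (by simp)
  exact ⟨C, hC⟩

end Purity


/-! ### Counting lattice points of dilations by cliques. -/

section Counting

variable {n d : ℕ} {α : Fin n → ℕ}

/-- The lattice points of the `k`-th dilation of the polytope spanned by `expVectors d α`. -/
def dilation (d : ℕ) (α : Fin n → ℕ) (k : ℕ) : Set (Fin n → ℕ) :=
  {w | ∑ i, w i = k * d ∧ ∀ i, w i ≤ k * α i}

lemma sum_mem_dilation {k : ℕ} {m : expVectors d α → ℕ} (hm : ∑ x, m x = k) :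
    (fun i => ∑ x, m x * x.1 i) ∈ dilation d α k := by
  constructor
  · rw [Finset.sum_comm, ← hm, Finset.sum_mul]
    refine Finset.sum_congr rfl fun x _ => ?_
    rw [← Finset.mul_sum, x.2.1]
  · intro i
    rw [← hm, Finset.sum_mul]
    exact Finset.sum_le_sum fun x _ => Nat.mul_le_mul_left _ (x.2.2 i)

open Classical in
lemma ncard_dilation {k : ℕ} (hk : 0 < k) :
    (dilation d α k).ncard =
      ((Finset.univ.piAntidiag k).filter (IsCliqueFun (d := d) (α := α))).card := by
  have hbij : Set.BijOn (fun (m : expVectors d α → ℕ) i => ∑ x, m x * x.1 i)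
      ((Finset.univ.piAntidiag k).filter (IsCliqueFun (d := d) (α := α))) (dilation d α k) := by
    refine ⟨fun m hm => ?_, fun m hm m' hm' h => ?_, fun w hw => ?_⟩
    · simp only [Finset.coe_filter, Finset.mem_piAntidiag, Set.mem_ofPred_eq] at hm
      exact sum_mem_dilation hm.1.1
    · simp only [Finset.coe_filter, Finset.mem_piAntidiag, Set.mem_ofPred_eq] at hm hm'
      exact hm.2.unique hm'.2 (hm.1.1.trans hm'.1.1.symm) (congrFun h)
    · obtain ⟨m, hm, hmk, hmw⟩ := exists_isCliqueFun hk hw.1 hw.2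
      refine ⟨m, ?_, funext hmw⟩
      simp [hm, hmk]
  rw [← hbij.image_eq, hbij.injOn.ncard_image, Set.ncard_coe_finset]

/-- The number of functions with support `C` and sum `k`. -/
lemma card_filter_support_eq {ι : Type*} [Fintype ι] [DecidableEq ι] {C : Finset ι}
    (hC : C.Nonempty) {k : ℕ} (hk : C.card ≤ k) :
    ((Finset.univ.piAntidiag k).filter fun m : ι → ℕ =>
      (Finset.univ.filter fun x => m x ≠ 0) = C).card = (k - 1).choose (C.card - 1) := by
  have hc := hC.card_pos
  have h1 : (k - 1).choose (C.card - 1) = (C.finsuppAntidiag (k - C.card)).card := by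
    rw [Finset.card_finsuppAntidiag_nat_eq_choose, Nat.add_sub_cancel' hk]
    exact (Nat.choose_symm_of_eq_add (by omega))
  rw [h1]
  symm
  -- Adding one on `C` turns weak compositions of `k - C.card` into compositions of `k` with full
  -- support `C`.
  refine Finset.card_bij (fun f _ x => f x + if x ∈ C then 1 else 0) ?_ ?_ ?_
  · intro f hf
    rw [Finset.mem_finsuppAntidiag] at hf
    have hout : ∀ x ∉ C, f x = 0 := fun x hx =>
      Finsupp.notMem_support_iff.1 fun h => hx (hf.2 h)
    simp only [Finset.mem_filter, Finset.mem_piAntidiag, Finset.mem_univ, implies_true, and_true]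
    constructor
    · rw [Finset.sum_add_distrib, ← Finset.sum_subset (Finset.subset_univ C) fun x _ hx => hout x hx,
        hf.1]
      simp
      omega
    · ext x
      by_cases hx : x ∈ C <;> simp [hx, hout]
  · intro f _ g _ h
    ext x
    exact Nat.add_right_cancel (congrFun h x)
  · intro m hm
    simp only [Finset.mem_filter, Finset.mem_piAntidiag, Finset.mem_univ, implies_true,
      and_true] at hm
    obtain ⟨hmk, hmC⟩ := hm
    have hmem : ∀ x, x ∈ C ↔ m x ≠ 0 := fun x => by rw [← hmC]; simp
    have hadd : ∀ x, (m x - if x ∈ C then 1 else 0) + (if x ∈ C then 1 else 0) = m x := by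
      intro x
      have := hmem x
      split_ifs <;> grind
    refine ⟨Finsupp.equivFunOnFinite.symm fun x => m x - if x ∈ C then 1 else 0, ?_, ?_⟩
    · rw [Finset.mem_finsuppAntidiag]
      constructor
      · have h2 : ∑ x, (m x - if x ∈ C then 1 else 0) + C.card = k := by
          rw [← hmk, ← Finset.sum_congr rfl fun x _ => hadd x, Finset.sum_add_distrib]
          simp
        have h3 : ∑ x ∈ C, (m x - if x ∈ C then 1 else 0) =
            ∑ x, (m x - if x ∈ C then 1 else 0) := by
          refine Finset.sum_subset (Finset.subset_univ C) fun x _ hx => ?_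
          have := hmem x
          simp only [hx, if_false]
          grind
        simp only [Finsupp.coe_equivFunOnFinite_symm]
        omega
      · intro x hx
        by_contra hxC
        have := hmem x
        simp [hxC] at hx this
        exact hx this
    · funext x
      exact hadd x

open Classical in
/-- The nonempty cliques of the sorting graph. -/
noncomputable def cliques (d : ℕ) (α : Fin n → ℕ) : Finset (Finset (expVectors d α)) :=
  Finset.univ.filter fun C =>
    (sortingGraph d α).IsClique (C : Set (expVectors d α)) ∧ C.Nonempty

lemma mem_cliques {C : Finset (expVectors d α)} : C ∈ cliques d α ↔
    (sortingGraph d α).IsClique (C : Set (expVectors d α)) ∧ C.Nonempty := by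
  simp [cliques]

/-- Group the decompositions by their support; `n ≤ k` ensures that no clique is larger than `k`. -/
lemma ncard_dilation_eq_sum (hn : 0 < n) {k : ℕ} (hk : n ≤ k) :
    (dilation d α k).ncard = ∑ C ∈ cliques d α, (k - 1).choose (C.card - 1) := by
  classical
  rw [ncard_dilation (hn.trans_le hk),
    Finset.card_eq_sum_card_fiberwise (f := fun m => Finset.univ.filter fun x => m x ≠ 0)
      (t := cliques d α)]
  · refine Finset.sum_congr rfl fun C hC => ?_
    rw [mem_cliques] at hC
    rw [← card_filter_support_eq hC.2 ((card_le_of_isClique hn hC.1).trans hk), Finset.filter_filter]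
    congr 1
    ext m
    simp only [Finset.mem_filter]
    refine and_congr_right fun _ => ⟨fun h => h.2, fun h => ⟨fun a b ha hb => ?_, h⟩⟩
    refine isClique_iff.1 hC.1 a ?_ b ?_
    · rw [← h]; simpa using ha
    · rw [← h]; simpa using hb
  · intro m hm
    simp only [Finset.coe_filter, Finset.mem_piAntidiag, Set.mem_ofPred_eq] at hm
    rw [Finset.mem_coe, mem_cliques]
    constructor
    · rw [isClique_iff]
      intro a ha b hb
      exact hm.2 a b (by simpa using ha) (by simpa using hb)
    · obtain ⟨x, hx, h⟩ := Finset.exists_ne_zero_of_sum_ne_zero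
        (s := Finset.univ) (f := m) (by rw [hm.1.1]; omega)
      exact ⟨x, by simpa using h⟩

lemma ncard_maximalCliques (hn : 0 < n) (hd : 0 < d) (hpos : ∀ i, 1 ≤ α i) (hlt : d < ∑ i, α i) :
    (maximalCliques d α).ncard = ((cliques d α).filter fun C => C.card = n).card := by
  classical
  rw [← Set.ncard_coe_finset, ← Set.ncard_image_of_injective _ Finset.coe_injective]
  congr 1
  ext C
  rw [mem_maximalCliques_iff hn hd hpos hlt]
  simp only [Finset.coe_filter, mem_cliques, Set.mem_image, Set.mem_ofPred_eq]
  constructor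
  · rintro ⟨h, hc⟩
    refine ⟨C.toFinset, ⟨⟨by simpa using h, ?_⟩, ?_⟩, by simp⟩
    · rw [Set.toFinset_nonempty]
      exact Set.nonempty_of_ncard_ne_zero (by omega)
    · exact (Set.ncard_eq_toFinset_card' C).symm.trans hc
  · rintro ⟨C, ⟨⟨h, -⟩, hc⟩, rfl⟩
    exact ⟨h, by rw [Set.ncard_coe_finset, hc]⟩

end Counting

/-! ### The Hilbert polynomial and its leading coefficient. -/

section Polynomials

open Polynomial

/-- The polynomial with value `(k - 1).choose s` at `k ≥ 1`. -/
noncomputable def choosePoly (s : ℕ) : ℚ[X] :=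
  C (1 / (s.factorial : ℚ)) * (descPochhammer ℚ s).comp (X - C 1)

lemma choosePoly_eval (s : ℕ) {k : ℕ} (hk : 0 < k) :
    (choosePoly s).eval (k : ℚ) = ((k - 1).choose s : ℚ) := by
  have h : (k : ℚ) - 1 = ((k - 1 : ℕ) : ℚ) := by
    rw [Nat.cast_sub (by omega), Nat.cast_one]
  rw [choosePoly, eval_mul, eval_C, eval_comp, eval_sub, eval_X, eval_C, h,
    descPochhammer_eval_eq_descFactorial, Nat.descFactorial_eq_factorial_mul_choose]
  have := Nat.factorial_ne_zero s
  push_cast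
  field_simp

lemma monic_descPochhammer_comp (s : ℕ) : ((descPochhammer ℚ s).comp (X - C 1)).Monic :=
  (monic_descPochhammer ℚ s).comp (monic_X_sub_C 1)
    (by rw [natDegree_X_sub_C]; exact one_ne_zero)

lemma natDegree_descPochhammer_comp (s : ℕ) :
    ((descPochhammer ℚ s).comp (X - C 1)).natDegree = s := by
  rw [natDegree_comp, natDegree_X_sub_C, mul_one, descPochhammer_natDegree]

lemma choosePoly_natDegree_le (s : ℕ) : (choosePoly s).natDegree ≤ s :=
  (natDegree_C_mul_le _ _).trans (natDegree_descPochhammer_comp s).le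

lemma choosePoly_coeff {s N : ℕ} (h : s ≤ N) :
    (choosePoly s).coeff N = if s = N then 1 / (N.factorial : ℚ) else 0 := by
  split_ifs with hs
  · subst hs
    have := (monic_descPochhammer_comp s).coeff_natDegree
    rw [natDegree_descPochhammer_comp] at this
    rw [choosePoly, coeff_C_mul, this, mul_one]
  · exact coeff_eq_zero_of_natDegree_lt ((choosePoly_natDegree_le s).trans_lt (by omega))

/-- The Hilbert polynomial. -/
noncomputable def hilbertPoly {n : ℕ} (d : ℕ) (α : Fin n → ℕ) : ℚ[X] :=
  ∑ C ∈ cliques d α, choosePoly (C.card - 1)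

variable {n d : ℕ} {α : Fin n → ℕ}

lemma hilbertPoly_eval (hn : 0 < n) {k : ℕ} (hk : n ≤ k) :
    (hilbertPoly d α).eval (k : ℚ) = ((dilation d α k).ncard : ℚ) := by
  rw [ncard_dilation_eq_sum hn hk, hilbertPoly, eval_finsetSum]
  push_cast
  exact Finset.sum_congr rfl fun C _ => choosePoly_eval _ (hn.trans_le hk)

/-- Only cliques with `n` elements reach degree `n - 1`, and each contributes `1 / (n - 1)!`. -/
lemma hilbertPoly_coeff (hn : 0 < n) (hd : 0 < d) (hpos : ∀ i, 1 ≤ α i) (hlt : d < ∑ i, α i) :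
    (hilbertPoly d α).coeff (n - 1) =
      ((maximalCliques d α).ncard : ℚ) / ((n - 1).factorial : ℚ) := by
  rw [hilbertPoly, finsetSum_coeff, ncard_maximalCliques hn hd hpos hlt, Finset.card_filter]
  push_cast
  rw [Finset.sum_div]
  refine Finset.sum_congr rfl fun C hC => ?_
  rw [mem_cliques] at hC
  have h1 := card_le_of_isClique hn hC.1
  have h2 := hC.2.card_pos
  rw [choosePoly_coeff (by omega), ite_div, zero_div]
  exact if_congr (by omega) rfl rfl

lemma hilbertPoly_natDegree_le (hn : 0 < n) : (hilbertPoly d α).natDegree ≤ n - 1 := by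
  refine natDegree_sum_le_of_forall_le _ _ fun C hC => ?_
  rw [mem_cliques] at hC
  have h1 := card_le_of_isClique hn hC.1
  exact (choosePoly_natDegree_le _).trans (by omega)

lemma hilbertPoly_natDegree (hn : 0 < n) (hd : 0 < d) (hpos : ∀ i, 1 ≤ α i)
    (hlt : d < ∑ i, α i) : (hilbertPoly d α).natDegree = n - 1 := by
  refine le_antisymm (hilbertPoly_natDegree_le hn) (le_natDegree_of_ne_zero ?_)
  rw [hilbertPoly_coeff hn hd hpos hlt]
  have h1 : (maximalCliques d α).ncard ≠ 0 :=
    ((Set.ncard_pos (Set.toFinite _)).2 (maximalCliques_nonempty d α)).ne'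
  have h2 := Nat.factorial_ne_zero (n - 1)
  positivity

end Polynomials


/-! ### Graded components and lattice points. -/

section HilbertFunction

open scoped Pointwise

variable {n d : ℕ} {α : Fin n → ℕ} (K : Type*) [Field K]

/-- The monomial with exponent vector `w`. -/
noncomputable def expMonomial (w : Fin n → ℕ) : MvPolynomial (Fin n) K :=
  ∏ i, MvPolynomial.X i ^ w i

lemma expMonomial_add (v w : Fin n → ℕ) :
    expMonomial K (fun i => v i + w i) = expMonomial K v * expMonomial K w := by
  simp [expMonomial, pow_add, Finset.prod_mul_distrib]

lemma expMonomial_eq_basis (w : Fin n → ℕ) :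
    expMonomial K w = MvPolynomial.basisMonomials (Fin n) K (Finsupp.equivFunOnFinite.symm w) := by
  rw [MvPolynomial.coe_basisMonomials]
  simp only
  rw [MvPolynomial.monomial_eq, expMonomial, Finsupp.prod_fintype _ _ (by simp)]
  simp

lemma expMonomial_ne_zero (w : Fin n → ℕ) : expMonomial K w ≠ 0 :=
  Finset.prod_ne_zero_iff.2 fun _ _ => pow_ne_zero _ (MvPolynomial.X_ne_zero _)

lemma expMonomial_mem_monomials {c : Fin n → ℕ} (hc : c ∈ expVectors d α) :
    expMonomial K c ∈ monomials K d α := ⟨c, hc, rfl⟩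

/-- The nontrivial inclusion is the integer decomposition property, supplied by
`exists_isCliqueFun`. -/
lemma monomials_pow_eq (k : ℕ) :
    monomials K d α ^ k = expMonomial K '' dilation d α k := by
  ext f
  constructor
  · induction k generalizing f with
    | zero =>
      intro hf
      refine ⟨fun _ => 0, ⟨by simp, by simp⟩, ?_⟩
      rw [pow_zero, Set.mem_one] at hf
      simp [hf, expMonomial]
    | succ k ih =>
      intro hf
      rw [pow_succ] at hf
      obtain ⟨g, hg, h, ⟨c, hc, rfl⟩, rfl⟩ := Set.mem_mul.1 hf
      obtain ⟨w, hw, rfl⟩ := ih g hg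
      refine ⟨fun i => w i + c i, ⟨?_, fun i => ?_⟩, expMonomial_add K w c⟩
      · rw [Finset.sum_add_distrib, hw.1, hc.1]; ring
      · have := hw.2 i
        have := hc.2 i
        simp only [add_mul]
        omega
  · rintro ⟨w, hw, rfl⟩
    rcases k.eq_zero_or_pos with rfl | hk
    · have : ∀ i, w i = 0 := fun i => by simpa using hw.2 i
      simp [expMonomial, this]
    obtain ⟨m, -, hmk, hmw⟩ := exists_isCliqueFun hk hw.1 hw.2
    have h1 : expMonomial K w = ∏ x, expMonomial K x.1 ^ m x := by
      simp only [expMonomial, ← Finset.prod_pow]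
      rw [Finset.prod_comm]
      refine Finset.prod_congr rfl fun i _ => ?_
      rw [← hmw, ← Finset.prod_pow_eq_pow_sum]
      refine Finset.prod_congr rfl fun x _ => ?_
      rw [← pow_mul, mul_comm]
    have h2 : ∀ s : Finset (expVectors d α),
        ∏ x ∈ s, expMonomial K x.1 ^ m x ∈ monomials K d α ^ ∑ x ∈ s, m x := by
      classical
      intro s
      induction s using Finset.induction_on with
      | empty => simp
      | insert x s hx ih =>
        rw [Finset.prod_insert hx, Finset.sum_insert hx, pow_add]
        exact Set.mul_mem_mul (Set.pow_mem_pow (expMonomial_mem_monomials K x.2)) ih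
    rw [h1, ← hmk]
    exact h2 _

lemma map_component (k : ℕ) :
    (component K d α k).map (algebra K d α).val.toLinearMap =
      Submodule.span K (expMonomial K '' dilation d α k) := by
  rw [component, Submodule.map_pow, Submodule.map_span, ← monomials_pow_eq, ← Submodule.span_pow]
  congr 2
  ext f
  constructor
  · rintro ⟨a, ha, rfl⟩
    exact ha
  · intro hf
    exact ⟨⟨f, Algebra.subset_adjoin hf⟩, hf, rfl⟩

lemma dilation_finite (d : ℕ) (α : Fin n → ℕ) (k : ℕ) : (dilation d α k).Finite :=
  (Set.finite_Iic fun i => k * α i).subset fun _ hw i => hw.2 i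

lemma finrank_component (k : ℕ) :
    Module.finrank K (component K d α k) = (dilation d α k).ncard := by
  have hinj : Function.Injective (algebra K d α).val.toLinearMap := Subtype.val_injective
  rw [(Submodule.equivMapOfInjective _ hinj _).finrank_eq, map_component, Set.image_eq_range]
  have : Fintype (dilation d α k) := (dilation_finite d α k).fintype
  have hli : LinearIndependent K fun w : dilation d α k => expMonomial K w.1 := by
    have := (MvPolynomial.basisMonomials (Fin n) K).linearIndependent.comp
      (fun w : dilation d α k => Finsupp.equivFunOnFinite.symm w.1)
      (Finsupp.equivFunOnFinite.symm.injective.comp Subtype.val_injective)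
    convert! this using 1
    funext w
    exact expMonomial_eq_basis K w.1
  rw [finrank_span_eq_card hli, ← Nat.card_eq_fintype_card, Nat.card_coe_set_eq]

end HilbertFunction

/-! ### The Krull dimension of the algebra. -/

section KrullDimension

/-- Incomparability makes contraction of primes strictly monotone; lying over and going up lift
chains. -/
lemma ringKrullDim_eq_of_isIntegral {R S : Type*} [CommRing R] [CommRing S] [Algebra R S]
    [Algebra.IsIntegral R S] [FaithfulSMul R S] : ringKrullDim S = ringKrullDim R := by
  refine le_antisymm ?_ ?_
  · refine Order.krullDim_le_of_strictMono (PrimeSpectrum.comap (algebraMap R S)) ?_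
    intro P Q hPQ
    exact Ideal.IsIntegral.comap_lt_comap hPQ
  · refine iSup_le fun l => ?_
    obtain ⟨P, -, hP, hPl⟩ := Ideal.exists_ideal_over_prime_of_isIntegral (S := S) l.head.asIdeal (⊥ : Ideal S) (by
      rw [Ideal.comap_bot_of_injective _ (FaithfulSMul.algebraMap_injective R S)]
      exact bot_le)
    have : P.LiesOver l.head.asIdeal := ⟨hPl.symm⟩
    obtain ⟨L, hL, -⟩ := Ideal.exists_ltSeries_of_hasGoingUp l P
    rw [← hL]
    exact le_iSup (fun p : LTSeries (PrimeSpectrum S) => (p.length : WithBot ℕ∞)) L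

universe u

/-- The Krull dimension of an affine domain is its transcendence degree. -/
lemma ringKrullDim_eq_of_trdeg_eq {K A : Type u} [Field K] [CommRing A] [IsDomain A] [Algebra K A]
    [Algebra.FiniteType K A] {N : ℕ} (h : Algebra.trdeg K A = N) : ringKrullDim A = N := by
  -- Noether normalization; the number of variables must then be the transcendence degree.
  obtain ⟨s, g, hg, hint⟩ := exists_integral_inj_algHom_of_fg K A
  algebraize [g.toRingHom]
  have : FaithfulSMul (MvPolynomial (Fin s) K) A :=
    (faithfulSMul_iff_algebraMap_injective _ _).2 hg
  have hs : s = N := by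
    have h1 := trdeg_add_eq K (MvPolynomial (Fin s) K) (A := A)
    rw [trdeg_eq_zero (R := MvPolynomial (Fin s) K) (A := A), h,
      MvPolynomial.trdeg_of_isDomain] at h1
    simpa using h1
  rw [ringKrullDim_eq_of_isIntegral (R := MvPolynomial (Fin s) K),
    MvPolynomial.ringKrullDim_of_isNoetherianRing, ringKrullDim_eq_zero_of_field]
  simp [hs]

lemma exists_sum_eq_of_le {ι : Type*} [Fintype ι] {d : ℕ} {u : ι → ℕ} (hu : d ≤ ∑ i, u i)
    (l : ι → ℕ) (hlu : l ≤ u) (hl : ∑ i, l i ≤ d) : ∃ v, l ≤ v ∧ v ≤ u ∧ ∑ i, v i = d := by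
  classical
  obtain ⟨k, hk⟩ := Nat.exists_eq_add_of_le hl
  induction k generalizing l with
  | zero => exact ⟨l, le_rfl, hlu, hk.symm⟩
  | succ k ih =>
    obtain ⟨i, -, hi⟩ := Finset.exists_lt_of_sum_lt (s := Finset.univ) (f := l) (g := u) (by omega)
    have hsum : ∑ j, (l + Pi.single i 1 : ι → ℕ) j = ∑ j, l j + 1 := by
      simp [Finset.sum_add_distrib]
    obtain ⟨v, h1, h2, h3⟩ := ih (l + Pi.single i 1) (fun j => by
      rcases eq_or_ne j i with rfl | hj
      · simpa using hi
      · simpa [hj] using hlu j) (by omega) (by omega)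
    exact ⟨v, le_trans (fun j => by simp) h1, h2, h3⟩

variable {n d : ℕ} {α : Fin n → ℕ} (K : Type u) [Field K]

lemma expMonomial_mem_algebra {c : Fin n → ℕ} (hc : c ∈ expVectors d α) :
    expMonomial K c ∈ algebra K d α := Algebra.subset_adjoin (expMonomial_mem_monomials K hc)

/-- The quotients of two variables are quotients of elements of the algebra. -/
lemma exists_X_mul_eq (hd : 0 < d) (hpos : ∀ i, 1 ≤ α i) (hlt : d < ∑ i, α i) (i j : Fin n) :
    ∃ p ∈ algebra K d α, ∃ q ∈ algebra K d α, p ≠ 0 ∧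
      MvPolynomial.X i * p = MvPolynomial.X j * q := by
  rcases eq_or_ne i j with rfl | hij
  · exact ⟨1, one_mem _, 1, one_mem _, one_ne_zero, rfl⟩
  have hα : ∑ l, (α - Pi.single i 1 : Fin n → ℕ) l + 1 = ∑ l, α l := by
    have : ∀ l, α l = (α - Pi.single i 1 : Fin n → ℕ) l + (Pi.single i 1 : Fin n → ℕ) l := by
      intro l
      rcases eq_or_ne l i with rfl | hl
      · have := hpos l
        simp only [Pi.sub_apply, Pi.single_eq_same]
        omega
      · simp [hl]
    conv_rhs => rw [Finset.sum_congr rfl fun l _ => this l]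
    rw [Finset.sum_add_distrib]
    simp
  -- Choose a vertex `v` with room to grow at `i` and a positive entry at `j`; then `v + e_i - e_j`
  -- is again a vertex. The strict inequality `d < ∑ i, α i` provides the room.
  obtain ⟨v, h1, h2, h3⟩ := exists_sum_eq_of_le (d := d) (u := α - Pi.single i 1) (by omega)
    (Pi.single j 1) (fun l => by
      rcases eq_or_ne l j with rfl | hl
      · simpa [hij.symm] using hpos l
      · simp [hl]) (by simpa using Nat.succ_le_of_lt hd)
  have hvj : 1 ≤ v j := by simpa using h1 j
  have hvi : v i + 1 ≤ α i := by
    have h4 := h2 i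
    have := hpos i
    simp only [Pi.sub_apply, Pi.single_eq_same] at h4
    omega
  have hvα : ∀ l, v l ≤ α l := fun l => (h2 l).trans (Nat.sub_le _ _)
  set v' : Fin n → ℕ := fun l => v l + (Pi.single i 1 : Fin n → ℕ) l - (Pi.single j 1 : Fin n → ℕ) l
    with hv'
  have hadd : ∀ l, v' l + (Pi.single j 1 : Fin n → ℕ) l = v l + (Pi.single i 1 : Fin n → ℕ) l := by
    intro l
    rcases eq_or_ne l j with rfl | hl
    · simp only [hv', Pi.single_eq_same]
      omega
    · simp [hv', hl]
  have hX : ∀ l : Fin n, expMonomial K (Pi.single l 1) = MvPolynomial.X l := by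
    intro l
    rw [expMonomial, Finset.prod_eq_single l]
    · simp
    · intro b _ hb
      simp [hb]
    · simp
  refine ⟨_, expMonomial_mem_algebra K ⟨h3, hvα⟩, expMonomial K v',
    expMonomial_mem_algebra K ⟨?_, fun l => ?_⟩, expMonomial_ne_zero K v, ?_⟩
  · have := Finset.sum_congr (rfl : (Finset.univ : Finset (Fin n)) = _) fun l _ => hadd l
    rw [Finset.sum_add_distrib, Finset.sum_add_distrib, h3] at this
    simpa using this
  · have h4 := hadd l
    have h5 := hvα l
    rcases eq_or_ne l i with rfl | hl
    · simp only [Pi.single_eq_same] at h4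
      omega
    · simp only [Pi.single_eq_of_ne hl] at h4
      omega
  · rw [← hX, ← hX, mul_comm, ← expMonomial_add, mul_comm, ← expMonomial_add]
    exact congrArg _ (funext fun l => (hadd l).symm)

/-- For a vertex `c`, the power `X_i ^ d` is `x^c` times the product of the `(X_i / X_j) ^ c_j`, and
these quotients lie in the fraction field of the algebra. Clearing denominators gives an equation `a
* X_i ^ d = b` with `a ≠ 0`. -/
lemma isAlgebraic_X (hd : 0 < d) (hpos : ∀ i, 1 ≤ α i) (hlt : d < ∑ i, α i) (i : Fin n) :
    IsAlgebraic (algebra K d α) (MvPolynomial.X i : MvPolynomial (Fin n) K) := by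
  choose p hp q hq hp0 hpq using exists_X_mul_eq K hd hpos hlt i
  obtain ⟨c, -, hcα, hcd⟩ := exists_sum_eq_of_le hlt.le (0 : Fin n → ℕ)
    (fun _ => Nat.zero_le _) (by simp)
  have hc : c ∈ expVectors d α := ⟨hcd, hcα⟩
  set a : algebra K d α := ⟨∏ j, p j ^ c j,
    Subalgebra.prod_mem _ fun j _ => pow_mem (hp j) _⟩ with ha
  set b : algebra K d α := ⟨expMonomial K c * ∏ j, q j ^ c j,
    mul_mem (expMonomial_mem_algebra K hc) (Subalgebra.prod_mem _ fun j _ => pow_mem (hq j) _)⟩ with hb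
  have ha0 : a ≠ 0 := by
    intro h
    have : ∏ j, p j ^ c j = 0 := congrArg Subtype.val h
    obtain ⟨j, -, hj⟩ := Finset.prod_eq_zero_iff.1 this
    exact pow_ne_zero _ (hp0 j) hj
  have hab : (a : MvPolynomial (Fin n) K) * (MvPolynomial.X i : MvPolynomial (Fin n) K) ^ d = b := by
    simp only [ha, hb, expMonomial]
    rw [← hcd, ← Finset.prod_pow_eq_pow_sum, ← Finset.prod_mul_distrib, ← Finset.prod_mul_distrib]
    refine Finset.prod_congr rfl fun j _ => ?_
    rw [← mul_pow, ← mul_pow, mul_comm, hpq]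
  refine ⟨Polynomial.C a * Polynomial.X ^ d - Polynomial.C b, ?_, ?_⟩
  · intro h
    have := congrArg (fun P => Polynomial.coeff P d) h
    simp only [Polynomial.coeff_sub, Polynomial.coeff_C_mul, Polynomial.coeff_X_pow_self, mul_one,
      Polynomial.coeff_C, hd.ne', if_false, sub_zero, Polynomial.coeff_zero] at this
    exact ha0 this
  · simp only [map_sub, map_mul, map_pow, Polynomial.aeval_C, Polynomial.aeval_X]
    rw [sub_eq_zero]
    exact hab

lemma isAlgebraic_mvPolynomial (hd : 0 < d) (hpos : ∀ i, 1 ≤ α i) (hlt : d < ∑ i, α i) :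
    Algebra.IsAlgebraic (algebra K d α) (MvPolynomial (Fin n) K) := by
  refine ⟨fun f => ?_⟩
  induction f using MvPolynomial.induction_on with
  | C a => exact isAlgebraic_algebraMap (algebraMap K (algebra K d α) a)
  | add p q hp hq => exact hp.add hq
  | mul_X p i hp => exact hp.mul (isAlgebraic_X K hd hpos hlt i)

lemma ringKrullDim_algebra (hd : 0 < d) (hpos : ∀ i, 1 ≤ α i) (hlt : d < ∑ i, α i) :
    ringKrullDim (algebra K d α) = n := by
  have hfin : (monomials K d α).Finite := by
    refine ((expVectors_finite d α).image (expMonomial K)).subset ?_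
    rintro _ ⟨c, hc, rfl⟩
    exact ⟨c, hc, rfl⟩
  have : Algebra.FiniteType K (algebra K d α) :=
    (Subalgebra.fg_iff_finiteType _).1 (Subalgebra.fg_def.2 ⟨_, hfin, rfl⟩)
  have := isAlgebraic_mvPolynomial K hd hpos hlt
  have h1 := trdeg_add_eq K (algebra K d α) (A := MvPolynomial (Fin n) K)
  rw [trdeg_eq_zero (R := algebra K d α), add_zero, MvPolynomial.trdeg_of_isDomain] at h1
  exact ringKrullDim_eq_of_trdeg_eq (by simpa using h1)

end KrullDimension

end VeroneseType

theorem corollary5p13 (K : Type*) [Field K] (n d : ℕ) (α : Fin n → ℕ)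
    (hn : 3 ≤ n) (hpos : ∀ i, 1 ≤ α i) (hmono : Monotone α) (hle : ∀ i, α i ≤ d)
    (hlt : d < ∑ i, α i) :
    VeroneseType.HasMultiplicity K (VeroneseType.algebra K d α)
      (VeroneseType.component K d α)
      (VeroneseType.maximalCliques d α).ncard := by
  have hn0 : 0 < n := by omega
  have hd : 0 < d := (hpos ⟨0, hn0⟩).trans (hle _)
  have hdeg := VeroneseType.hilbertPoly_natDegree hn0 hd hpos hlt
  have hne : VeroneseType.hilbertPoly d α ≠ 0 := by
    intro h
    rw [h, Polynomial.natDegree_zero] at hdeg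
    omega
  refine ⟨n, VeroneseType.hilbertPoly d α, hn0,
    VeroneseType.ringKrullDim_algebra K hd hpos hlt, ?_, ?_, ?_⟩
  · filter_upwards [Filter.eventually_ge_atTop n] with k hk
    rw [VeroneseType.finrank_component, VeroneseType.hilbertPoly_eval hn0 hk]
  · rw [Polynomial.degree_eq_natDegree hne, hdeg]
  · rw [Polynomial.leadingCoeff, hdeg, VeroneseType.hilbertPoly_coeff hn0 hd hpos hlt]
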